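/- Fix a finite $n>0$. Formulas are built from letters $p_0,p_1,\dots$ by $\bot,\to,\Diamond_0,\dots,\Diamond_{n-1}$ (other connectives are abbreviations); for $k<\omega$, a $k$-formula is a formula whose letters are among $p_0,\dots,p_{k-1}$. A logic is a set of formulas that contains all classical tautologies, $\Diamond_i(p_0\vee p_1)\to\Diamond_i p_0\vee\Diamond_i p_1$ and $\neg\Diamond_i\bot$ for all $i<n$, and is closed under modus ponens, substitution and monotonicity (from $\varphi\to\psi$ infer $\Diamond_i\varphi\to\Diamond_i\psi$). It is consistent if it does not contain $\bot$, and $k$-tabular if there are only finitely many $k$-formulas up to the equivalence $\varphi\leftrightarrow\psi\in L$. Put $\Diamond^0\varphi=\varphi$, $\Diamond^{m+1}\varphi=\Diamond^m(\Diamond_0\varphi\vee\dots\vee\Diamond_{n-1}\varphi)$, $\Diamond^{\le m}\varphi=\bigvee_{l\le m}\Diamond^l\varphi$. A logic $L$ is pretransitive if $\Diamond^{m+1}p_0\to\Diamond^{\le m}p_0\in L$ for some $m\ge 0$; for the least such $m$ write $\Diamond^*=\Diamond^{\le m}$ and $\Box^*=\neg\Diamond^{*}\neg$. Let $B_0=\bot$,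 $B_{j+1}=p_{j+1}\to\Box^*(\Diamond^*p_{j+1}\vee B_j)$, and let $L[h]$ be the smallest logic containing $L\cup\{B_h\}$. In a frame $F=(W,(R_i)_{i<n})$ let $R_F^*$ be the reflexive transitive closure of $\bigcup_{i<n}R_i$. The height of $F$ is the maximal number of elements in a chain of the poset of equivalence classes (clusters) of the preorder $(W,R_F^*)$, and $\infty$ if there are arbitrarily large finite chains. The depth of $x\in W$ is the height of the restriction of $F$ to $\{y : xR_F^*y\}$. For $0<h<\omega$, $F$ is $h$-heavy if for every $x$ whose depth is not $\le h$ there is $y$ with $xR_F^*y$ whose depth is exactly $h$. The $k$-canonical frame of a consistent logic $L$ consists of the maximal $L$-consistent sets of $k$-formulas, with $xR_iy$ iff $\Diamond_i\varphi\in x$ for all $\varphi\in y$. **Theorem.** Let $L$ be a consistent pretransitive logic and $h,k<\omega$. If $L[h]$ is $k$-tabular, then: 1. for every $i\le h$ there is a $k$-formula $B_{i,k}$ such that for every point $x$ of the $k$-canonical frame of $L$, $B_{i,k}\in x$ if and only if the depth of $x$ in that frame is at most $i$; 2. the $k$-canonical frame of $L$ is $(h+1)$-heavy. -/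

import Mathlib

namespace PretransModal

/-- `n`-modal formulas over the proposition letters `p_0, p_1, …`. -/
inductive Formula (n : ℕ) : Type
  | var (j : ℕ) : Formula n
  | bot : Formula n
  | imp (φ ψ : Formula n) : Formula n
  | dia (i : Fin n) (φ : Formula n) : Formula n

namespace Formula

variable {n : ℕ}

def neg (φ : Formula n) : Formula n := imp φ bot

def top : Formula n := neg bot

def or (φ ψ : Formula n) : Formula n := imp (neg φ) ψ

def and (φ ψ : Formula n) : Formula n := neg (imp φ (neg ψ))

def iff (φ ψ : Formula n) : Formula n := and (imp φ ψ) (imp ψ φ)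

/-- Finite disjunction (the empty one is `⊥`). -/
def bigOr : List (Formula n) → Formula n
  | [] => bot
  | φ :: l => or φ (bigOr l)

/-- Finite conjunction (the empty one is `⊤`). -/
def bigAnd : List (Formula n) → Formula n
  | [] => top
  | φ :: l => and φ (bigAnd l)

/-- Uniform substitution of formulas for proposition letters. -/
def subst (σ : ℕ → Formula n) : Formula n → Formula n
  | var j => σ j
  | bot => bot
  | imp φ ψ => imp (subst σ φ) (subst σ ψ)
  | dia i φ => dia i (subst σ φ)

/-- `φ` is a `k`-formula: all its proposition letters are among `p_0, …, p_{k-1}`. -/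
def IsKFormula (k : ℕ) : Formula n → Prop
  | var j => j < k
  | bot => True
  | imp φ ψ => IsKFormula k φ ∧ IsKFormula k ψ
  | dia _ φ => IsKFormula k φ

/-- Classical tautology: true under every Boolean assignment to formulas, where letters and
formulas `◇_i φ` get arbitrary values. -/
def IsTautology (φ : Formula n) : Prop :=
  ∀ v : Formula n → Prop, ¬ v bot → (∀ α β, v (imp α β) ↔ (v α → v β)) → v φ

/-- `◇_0 φ ∨ … ∨ ◇_{n-1} φ`. -/
def diaAny (φ : Formula n) : Formula n := bigOr (List.ofFn fun i : Fin n => dia i φ)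

/-- `◇^m φ`. -/
def diaPow : ℕ → Formula n → Formula n
  | 0, φ => φ
  | m + 1, φ => diaPow m (diaAny φ)

/-- `◇^{≤ m} φ`. -/
def diaLe (m : ℕ) (φ : Formula n) : Formula n :=
  bigOr ((List.range (m + 1)).map fun l => diaPow l φ)

/-- `□^{≤ m} φ`. -/
def boxLe (m : ℕ) (φ : Formula n) : Formula n := neg (diaLe m (neg φ))

/-- The formula `B_h` of height `≤ h`, with `◇^{≤ m}` in the role of `◇^*`. -/
def heightFormula (m : ℕ) : ℕ → Formula n
  | 0 => bot
  | i + 1 =>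
      imp (var (i + 1)) (boxLe m (or (diaLe m (var (i + 1))) (heightFormula m i)))

end Formula

open Formula

section Logics

variable {n : ℕ}

/-- Propositional `n`-modal normal logics, as sets of formulas. -/
structure IsLogic (L : Set (Formula n)) : Prop where
  taut : ∀ φ, IsTautology φ → φ ∈ L
  dia_or : ∀ i, imp (dia i (or (var 0) (var 1))) (or (dia i (var 0)) (dia i (var 1))) ∈ L
  dia_bot : ∀ i, neg (dia i bot) ∈ L
  mp : ∀ φ ψ, imp φ ψ ∈ L → φ ∈ L → ψ ∈ L
  subst : ∀ (σ : ℕ → Formula n) (φ), φ ∈ L → φ.subst σ ∈ L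
  mono : ∀ (i) (φ ψ), imp φ ψ ∈ L → imp (dia i φ) (dia i ψ) ∈ L

def IsConsistentLogic (L : Set (Formula n)) : Prop := bot ∉ L

/-- `L + Ψ`, the smallest logic containing `L ∪ Ψ`. -/
def addAxioms (L Ψ : Set (Formula n)) : Set (Formula n) :=
  ⋂₀ {L' | IsLogic L' ∧ L ∪ Ψ ⊆ L'}

theorem isLogic_addAxioms (L Ψ : Set (Formula n)) : IsLogic (addAxioms L Ψ) where
  taut φ h := fun _ hL' => hL'.1.taut φ h
  dia_or i := fun _ hL' => hL'.1.dia_or i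
  dia_bot i := fun _ hL' => hL'.1.dia_bot i
  mp φ ψ h₁ h₂ := fun L' hL' => hL'.1.mp φ ψ (h₁ L' hL') (h₂ L' hL')
  subst σ φ h := fun L' hL' => hL'.1.subst σ φ (h L' hL')
  mono i φ ψ h := fun L' hL' => hL'.1.mono i φ ψ (h L' hL')

def IsTransitiveLogic (m : ℕ) (L : Set (Formula n)) : Prop :=
  imp (diaPow (m + 1) (var 0)) (diaLe m (var 0)) ∈ L

def IsPretransitive (L : Set (Formula n)) : Prop := ∃ m, IsTransitiveLogic m L

/-- The least `m` such that a pretransitive logic `L` is `m`-transitive. For pretransitive `L` the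
modality `◇^*` is `◇^{≤ m}` with this `m`. -/
noncomputable def transIndex (L : Set (Formula n)) : ℕ := sInf {m | IsTransitiveLogic m L}

/-- `L[h] = L + B_h`, for pretransitive `L`. -/
noncomputable def heightExtension (L : Set (Formula n)) (h : ℕ) : Set (Formula n) :=
  addAxioms L {heightFormula (transIndex L) h}

/-- `k`-tabularity: up to equivalence in `L` there are only finitely many `k`-formulas. -/
def IsTabular (k : ℕ) (L : Set (Formula n)) : Prop :=
  ∃ S : Set (Formula n), S.Finite ∧ (∀ ψ ∈ S, IsKFormula k ψ) ∧
    ∀ φ, IsKFormula k φ → ∃ ψ ∈ S, iff φ ψ ∈ L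

/-- `Γ` is `L`-consistent: `L` refutes no conjunction of finitely many members of `Γ`. -/
def IsConsistentSet (L Γ : Set (Formula n)) : Prop :=
  ∀ l : List (Formula n), (∀ φ ∈ l, φ ∈ Γ) → neg (bigAnd l) ∉ L

/-- The points of the `k`-canonical frame: maximal `L`-consistent sets of `k`-formulas. -/
def CanonicalPoint (L : Set (Formula n)) (k : ℕ) : Type :=
  {x : Set (Formula n) //
    Maximal (fun Γ => (∀ φ ∈ Γ, IsKFormula k φ) ∧ IsConsistentSet L Γ) x}

theorem nonempty_canonicalPoint {L : Set (Formula n)} (hL : IsLogic L)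
    (hc : IsConsistentLogic L) (k : ℕ) : Nonempty (CanonicalPoint L k) := by
  have hF : Order.IsOfFiniteCharacter
      {Γ : Set (Formula n) | (∀ φ ∈ Γ, IsKFormula k φ) ∧ IsConsistentSet L Γ} := by
    intro Γ
    constructor
    · rintro ⟨h₁, h₂⟩ Δ hΔ -
      exact ⟨fun φ hφ => h₁ φ (hΔ hφ), fun l hl => h₂ l fun φ hφ => hΔ (hl φ hφ)⟩
    · intro h
      refine ⟨fun φ hφ => ?_, fun l hl => ?_⟩
      · exact (h {φ} (by simpa using hφ) (Set.finite_singleton φ)).1 φ rfl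
      · exact (h {φ | φ ∈ l} hl l.finite_toSet).2 l fun φ hφ => hφ
  have h0 : (∅ : Set (Formula n)) ∈
      {Γ : Set (Formula n) | (∀ φ ∈ Γ, IsKFormula k φ) ∧ IsConsistentSet L Γ} := by
    refine ⟨fun φ hφ => hφ.elim, fun l hl hneg => hc ?_⟩
    obtain rfl : l = [] := List.eq_nil_iff_forall_not_mem.2 fun φ hφ => hl φ hφ
    refine hL.mp _ _ hneg (hL.taut _ fun v hb hi => ?_)
    simp only [bigAnd, top, neg, hi]
    exact id
  obtain ⟨Γ, -, hΓ⟩ := hF.exists_maximal h0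
  exact ⟨⟨Γ, hΓ⟩⟩

end Logics

/-- Kripke frames `(W, (R_i)_{i<n})`, `W ≠ ∅`. -/
structure Frame (n : ℕ) where
  World : Type
  nonempty : Nonempty World
  rel : Fin n → World → World → Prop

namespace Frame

variable {n : ℕ} (F : Frame n)

/-- `R_F^*`, the reflexive transitive closure of `R_F = ⋃_i R_i`. -/
def RStar : F.World → F.World → Prop :=
  Relation.ReflTransGen fun x y => ∃ i, F.rel i x y

/-- The preorder `(W, R_F^*)`. -/
abbrev toPreorder : Preorder F.World where
  le := F.RStar
  le_refl _ := Relation.ReflTransGen.refl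
  le_trans _ _ _ := Relation.ReflTransGen.trans

/-- The skeleton of `F`: the clusters (classes of the equivalence `R_F^* ∩ (R_F^*)⁻¹`). -/
def Skeleton : Type :=
  letI := F.toPreorder
  Antisymmetrization F.World (· ≤ ·)

/-- The skeleton is ordered by the relation that `R_F^*` induces on clusters. -/
instance : PartialOrder F.Skeleton :=
  @instPartialOrderAntisymmetrization F.World F.toPreorder

/-- The height of `F`: the largest number of elements of a chain of clusters
(`⊤` if there are arbitrarily large chains). -/
noncomputable def height : ℕ∞ := (Set.univ : Set F.Skeleton).chainHeight (· ≤ ·)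

/-- The restriction of `F` to a non-empty set of points. -/
def restrict (V : Set F.World) (hV : V.Nonempty) : Frame n where
  World := V
  nonempty := hV.to_subtype
  rel i x y := F.rel i x.1 y.1

/-- The restriction of `F` to `R_F^*(x)`. -/
def cone (x : F.World) : Frame n :=
  F.restrict {y | F.RStar x y} ⟨x, Relation.ReflTransGen.refl⟩

/-- The depth of `x` in `F`. -/
noncomputable def depth (x : F.World) : ℕ∞ := (F.cone x).height

/-- `F` is `h`-heavy (for positive finite `h`): every point that is not of depth `≤ h` is
`R_F^*`-below a point of depth exactly `h`. -/
def IsHeavy (h : ℕ) : Prop :=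
  ∀ x : F.World, ¬ F.depth x ≤ h → ∃ y, F.RStar x y ∧ F.depth y = h

end Frame

/-- The `k`-canonical frame of a consistent logic `L`. -/
def canonicalFrame {n : ℕ} (L : Set (Formula n)) (hL : IsLogic L) (hc : IsConsistentLogic L)
    (k : ℕ) : Frame n where
  World := CanonicalPoint L k
  nonempty := nonempty_canonicalPoint hL hc k
  rel i x y := ∀ φ ∈ y.1, dia i φ ∈ x.1

end PretransModal

/-! Two facts describe the canonical frame. Saturation (`exists_rel_of_directedOn` and its iterates)
realises a directed set of formulas at a single successor, so `x R* y` holds as soon as ◇*φ holds at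
x for each φ true at y (`rStar_of_forall_holds`). Consequently x has depth ≤ i iff all substitution
instances of B_i hold at x (`depth_le_iff`). Since B_i may use letters beyond p_{k-1}, truth is read
after replacing those letters by ⊥ (`Holds`).

Part 1 compresses these infinitely many instances into one k-formula. For i ≤ h the logic L[i]
extends L[h], hence is k-tabular, and the operation table of its finite algebra of k-formulas is a
single k-formula D in L[i] (`IsTabular.exists_axiom`). If D holds throughout the cone of x, all of
L[i] holds at x, so the depth is ≤ i. Conversely L[i] holds wherever the depth is ≤ i. So □*D
defines depth ≤ i.

For part 2, let B define depth ≤ h. A point of larger depth satisfies ¬B and, by Zorn, sees an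
R*-maximal point y satisfying ¬B (`CanonicalPoint.exists_maximal_holds`). All points strictly above
y have depth ≤ h and y does not, so y has depth exactly h + 1. -/

section ChainHeight

variable {α : Type*} [PartialOrder α]

theorem Set.chainHeight_Ici_le_add_one_iff (a : α) (i : ℕ) :
    (Set.Ici a).chainHeight (· ≤ ·) ≤ ((i + 1 : ℕ) : ℕ∞) ↔
      ∀ b, a < b → (Set.Ici b).chainHeight (· ≤ ·) ≤ (i : ℕ∞) := by
  constructor
  · intro h b hab
    refine iSup_le fun ⟨t, ht, hct⟩ => ?_
    have hat : a ∉ t := fun hat => not_le_of_gt hab (ht hat)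
    have hle : (insert a t).encard ≤ ((i + 1 : ℕ) : ℕ∞) := by
      refine (Set.encard_le_chainHeight_of_isChain (Set.Ici a) _ ?_ ?_).trans h
      · exact Set.insert_subset (Set.mem_Ici.2 le_rfl) fun c hc => hab.le.trans (ht hc)
      · exact hct.insert fun c hc _ => Or.inl (hab.le.trans (ht hc))
    rw [Set.encard_insert_of_notMem hat] at hle
    push_cast at hle
    exact (ENat.add_le_add_iff_right ENat.one_ne_top).1 hle
  · intro h
    refine iSup_le fun ⟨t, ht, hct⟩ => ?_
    have key : (t \ {a}).encard ≤ (i : ℕ∞) := by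
      by_contra hlt
      -- The chain may be infinite without a least element. A subset of exactly i + 1 elements has a
      -- least element b, and lies above b.
      obtain ⟨u, hut, hu⟩ := Set.exists_subset_encard_eq (Order.add_one_le_of_lt (not_le.1 hlt))
      have hufin : u.Finite := Set.finite_of_encard_eq_coe (k := i + 1) (by rw [hu]; norm_cast)
      have hune : u.Nonempty := by
        rw [← Set.encard_ne_zero, hu]
        exact add_ne_zero.mpr (Or.inr one_ne_zero)
      obtain ⟨b, hbu, hb⟩ := hufin.exists_minimal hune
      have hcu : IsChain (· ≤ ·) u := hct.mono (hut.trans Set.sdiff_subset)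
      have hsub : u ⊆ Set.Ici b := fun c hc => by
        rcases hcu.total hbu hc with h | h
        · exact h
        · exact hb hc h
      have hab : a < b := lt_of_le_of_ne (ht (hut hbu).1) fun e => (hut hbu).2 e.symm
      have := (Set.encard_le_chainHeight_of_isChain _ _ hsub hcu).trans (h b hab)
      rw [hu] at this
      exact absurd this (by exact_mod_cast Nat.not_succ_le_self i)
    calc t.encard ≤ (insert a (t \ {a})).encard := Set.encard_le_encard (by
            intro c hc; by_cases hca : c = a <;> simp [hca, hc])
      _ ≤ (t \ {a}).encard + 1 := Set.encard_insert_le _ _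
      _ ≤ ((i + 1 : ℕ) : ℕ∞) := by push_cast; gcongr

end ChainHeight

/-! ### Depth as chain height above a cluster -/

namespace PretransModal

namespace Frame

variable {n : ℕ} (F : Frame n)

/-- The cluster of a point. -/
def cluster (x : F.World) : F.Skeleton :=
  letI := F.toPreorder
  toAntisymmetrization (· ≤ ·) x

theorem cluster_le_cluster {x y : F.World} : F.cluster x ≤ F.cluster y ↔ F.RStar x y := Iff.rfl

theorem cluster_surjective : Function.Surjective F.cluster := fun q =>
  letI := F.toPreorder
  Antisymmetrization.ind (r := (· ≤ ·)) (p := fun q : F.Skeleton => ∃ x, F.cluster x = q)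
    (fun x => ⟨x, rfl⟩) q

theorem rStar_cone {x : F.World} (y z : (F.cone x).World) :
    (F.cone x).RStar y z ↔ F.RStar y.1 z.1 := by
  constructor
  · intro h
    exact Relation.ReflTransGen.lift (p := fun a b => ∃ i, F.rel i a b)
      (fun w : (F.cone x).World => w.1) (fun _ _ h => h) _ _ h
  · obtain ⟨z, hz⟩ := z
    intro h
    change F.RStar y.1 z at h
    induction h with
    | refl => exact Relation.ReflTransGen.refl
    | @tail b c hb hbc ih =>
      exact Relation.ReflTransGen.tail (ih (Relation.ReflTransGen.trans y.2 hb)) hbc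

/-- A cone is closed under the relations, so its skeleton is an up-set of the skeleton of `F` with
the induced order. Depths of different points thereby become comparable inside one poset. -/
theorem depth_eq_chainHeight (x : F.World) :
    F.depth x = (Set.Ici (F.cluster x)).chainHeight (· ≤ ·) := by
  have hex : ∀ q : (F.cone x).Skeleton, ∃ y, (F.cone x).cluster y = q :=
    (F.cone x).cluster_surjective
  choose g hg using hex
  have hle : ∀ p q, F.cluster (g p).1 ≤ F.cluster (g q).1 ↔ p ≤ q := fun p q => by
    rw [cluster_le_cluster, ← rStar_cone, ← cluster_le_cluster, hg, hg]
  let e : (F.cone x).Skeleton ↪o F.Skeleton :=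
    OrderEmbedding.ofMapLEIff (fun q => F.cluster (g q).1) hle
  have himg : e '' Set.univ = Set.Ici (F.cluster x) := by
    ext q
    simp only [Set.image_univ, Set.mem_range, Set.mem_Ici]
    constructor
    · rintro ⟨p, rfl⟩
      exact F.cluster_le_cluster.2 (g p).2
    · intro hq
      obtain ⟨y, rfl⟩ := F.cluster_surjective q
      let y' : (F.cone x).World := ⟨y, F.cluster_le_cluster.1 hq⟩
      refine ⟨(F.cone x).cluster y', ?_⟩
      have h := hg ((F.cone x).cluster y')
      change F.cluster (g ((F.cone x).cluster y')).1 = F.cluster y'.1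
      refine le_antisymm ?_ ?_ <;>
        rw [cluster_le_cluster, ← rStar_cone, ← cluster_le_cluster, h]
  rw [← himg]
  exact (Set.chainHeight_eq_of_relEmbedding Set.univ e).symm

theorem not_depth_le_zero (x : F.World) : ¬ F.depth x ≤ ((0 : ℕ) : ℕ∞) := by
  rw [depth_eq_chainHeight, Nat.cast_zero, nonpos_iff_eq_zero, Set.chainHeight_eq_zero_iff]
  exact Set.nonempty_Ici.ne_empty

/-- This recursion on strict successors is the one that the formulas B_i mirror. -/
theorem depth_le_add_one_iff (x : F.World) (i : ℕ) :
    F.depth x ≤ ((i + 1 : ℕ) : ℕ∞) ↔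
      ∀ y, F.RStar x y → ¬ F.RStar y x → F.depth y ≤ (i : ℕ∞) := by
  simp only [depth_eq_chainHeight]
  rw [Set.chainHeight_Ici_le_add_one_iff]
  constructor
  · intro h y hxy hyx
    exact h _ (lt_of_le_not_ge (F.cluster_le_cluster.2 hxy) hyx)
  · intro h q hq
    obtain ⟨y, rfl⟩ := F.cluster_surjective q
    exact h y hq.le hq.not_ge

theorem depth_anti {x y : F.World} (h : F.RStar x y) : F.depth y ≤ F.depth x := by
  rw [depth_eq_chainHeight, depth_eq_chainHeight]
  exact Set.chainHeight_mono _ _ _ (Set.Ici_subset_Ici.2 h)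

end Frame
end PretransModal

namespace PretransModal

open Formula

variable {n : ℕ}

/-! ### Boolean valuations and syntactic operations -/

/-- A Boolean valuation of formulas, with letters and formulas `◇_i φ` valued arbitrarily. -/
structure IsValuation (v : Formula n → Prop) : Prop where
  bot : ¬ v bot
  imp : ∀ α β, v (imp α β) ↔ (v α → v β)

namespace IsValuation

variable {v : Formula n → Prop} (hv : IsValuation v)
include hv

theorem neg (φ : Formula n) : v φ.neg ↔ ¬ v φ := by
  simp [Formula.neg, hv.imp, hv.bot]

theorem top : v Formula.top := by simp [Formula.top, hv.neg, hv.bot]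

theorem or (φ ψ : Formula n) : v (φ.or ψ) ↔ v φ ∨ v ψ := by
  simp only [Formula.or, hv.imp, hv.neg]; tauto

theorem and (φ ψ : Formula n) : v (φ.and ψ) ↔ v φ ∧ v ψ := by
  simp only [Formula.and, hv.imp, hv.neg]; tauto

theorem iff (φ ψ : Formula n) : v (φ.iff ψ) ↔ (v φ ↔ v ψ) := by
  simp only [Formula.iff, hv.imp, hv.and]; tauto

theorem bigOr (l : List (Formula n)) : v (Formula.bigOr l) ↔ ∃ φ ∈ l, v φ := by
  induction l with
  | nil => simp [Formula.bigOr, hv.bot]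
  | cons φ l ih => simp [Formula.bigOr, hv.or, ih]

theorem bigAnd (l : List (Formula n)) : v (Formula.bigAnd l) ↔ ∀ φ ∈ l, v φ := by
  induction l with
  | nil => simp [Formula.bigAnd, hv.top]
  | cons φ l ih => simp [Formula.bigAnd, hv.and, ih]

theorem diaAny (φ : Formula n) : v φ.diaAny ↔ ∃ i, v (dia i φ) := by
  simp [Formula.diaAny, hv.bigOr, List.mem_ofFn]

theorem diaLe (m : ℕ) (φ : Formula n) : v (φ.diaLe m) ↔ ∃ l ≤ m, v (φ.diaPow l) := by
  simp [Formula.diaLe, hv.bigOr]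

end IsValuation

namespace Formula

theorem subst_subst (σ τ : ℕ → Formula n) (φ : Formula n) :
    (φ.subst σ).subst τ = φ.subst fun j => (σ j).subst τ := by
  induction φ <;> simp_all [subst]

theorem subst_bigOr (σ : ℕ → Formula n) (l : List (Formula n)) :
    (bigOr l).subst σ = bigOr (l.map (subst σ)) := by
  induction l with
  | nil => rfl
  | cons φ l ih => simp [bigOr, or, neg, subst, ih]

theorem subst_diaAny (σ : ℕ → Formula n) (φ : Formula n) :
    φ.diaAny.subst σ = (φ.subst σ).diaAny := by
  simp [diaAny, subst_bigOr, List.map_ofFn, Function.comp_def, subst]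

theorem subst_diaPow (σ : ℕ → Formula n) (l : ℕ) (φ : Formula n) :
    (φ.diaPow l).subst σ = (φ.subst σ).diaPow l := by
  induction l generalizing φ with
  | zero => rfl
  | succ l ih => simp [diaPow, ih, subst_diaAny]

theorem subst_diaLe (σ : ℕ → Formula n) (m : ℕ) (φ : Formula n) :
    (φ.diaLe m).subst σ = (φ.subst σ).diaLe m := by
  simp [diaLe, subst_bigOr, Function.comp_def, subst_diaPow]

theorem subst_boxLe (σ : ℕ → Formula n) (m : ℕ) (φ : Formula n) :
    (φ.boxLe m).subst σ = (φ.subst σ).boxLe m := by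
  simp [boxLe, neg, subst, subst_diaLe]

theorem subst_heightFormula_succ (σ : ℕ → Formula n) (m i : ℕ) :
    (heightFormula m (i + 1)).subst σ =
      imp (σ (i + 1)) (boxLe m (or (diaLe m (σ (i + 1))) ((heightFormula m i).subst σ))) := by
  simp [heightFormula, subst, subst_boxLe, or, neg, subst_diaLe]

/-- Only p_1, …, p_i occur in B_i, so the value of p_{i+1} can be chosen independently of an
instance of B_i. -/
theorem subst_heightFormula_congr {σ τ : ℕ → Formula n} (m i : ℕ) (h : ∀ j ≤ i, σ j = τ j) :
    (heightFormula m i).subst σ = (heightFormula m i).subst τ := by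
  induction i with
  | zero => rfl
  | succ i ih =>
    rw [subst_heightFormula_succ, subst_heightFormula_succ, h _ le_rfl,
      ih fun j hj => h j (hj.trans i.le_succ)]

theorem IsKFormula.subst {k : ℕ} {σ : ℕ → Formula n} (hσ : ∀ j, (σ j).IsKFormula k)
    (φ : Formula n) : (φ.subst σ).IsKFormula k := by
  induction φ <;> simp_all [Formula.subst, IsKFormula]

theorem IsKFormula.bigOr {k : ℕ} {l : List (Formula n)} (h : ∀ φ ∈ l, φ.IsKFormula k) :
    (Formula.bigOr l).IsKFormula k := by
  induction l with
  | nil => trivial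
  | cons φ l ih => simp_all [Formula.bigOr, Formula.or, Formula.neg, IsKFormula]

theorem IsKFormula.bigAnd {k : ℕ} {l : List (Formula n)} (h : ∀ φ ∈ l, φ.IsKFormula k) :
    (Formula.bigAnd l).IsKFormula k := by
  induction l with
  | nil => simp [Formula.bigAnd, Formula.top, Formula.neg, IsKFormula]
  | cons φ l ih => simp_all [Formula.bigAnd, Formula.and, Formula.neg, IsKFormula]

theorem IsKFormula.diaPow {k : ℕ} {φ : Formula n} (h : φ.IsKFormula k) (l : ℕ) :
    (φ.diaPow l).IsKFormula k := by
  induction l generalizing φ with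
  | zero => exact h
  | succ l ih =>
    refine ih (IsKFormula.bigOr fun ψ hψ => ?_)
    obtain ⟨i, rfl⟩ := List.mem_ofFn.1 hψ
    exact h

theorem IsKFormula.boxLe {k : ℕ} {φ : Formula n} (h : φ.IsKFormula k) (m : ℕ) :
    (φ.boxLe m).IsKFormula k := by
  refine ⟨IsKFormula.bigOr fun ψ hψ => ?_, trivial⟩
  obtain ⟨l, -, rfl⟩ := List.mem_map.1 hψ
  exact IsKFormula.diaPow (φ := φ.neg) ⟨h, trivial⟩ l

/-- The substitution that replaces all letters but `p_0, …, p_{k-1}` by `⊥`. -/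
def restrictLetters (k : ℕ) (j : ℕ) : Formula n := if j < k then var j else bot

theorem isKFormula_restrictLetters (k j : ℕ) :
    (restrictLetters k j : Formula n).IsKFormula k := by
  unfold restrictLetters
  split_ifs with h
  · exact h
  · trivial

theorem IsKFormula.subst_restrictLetters {k : ℕ} {φ : Formula n} (h : φ.IsKFormula k) :
    φ.subst (restrictLetters k) = φ := by
  induction φ <;> simp_all [Formula.subst, IsKFormula, restrictLetters]

theorem isKFormula_subst_restrictLetters (k : ℕ) (φ : Formula n) :
    (φ.subst (restrictLetters k)).IsKFormula k :=
  IsKFormula.subst (isKFormula_restrictLetters k) φ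

theorem subst_restrictLetters_idem (k : ℕ) (φ : Formula n) :
    (φ.subst (restrictLetters k)).subst (restrictLetters k) = φ.subst (restrictLetters k) :=
  (isKFormula_subst_restrictLetters k φ).subst_restrictLetters

end Formula

/-! ### Derivations in a logic -/

namespace IsLogic

variable {L : Set (Formula n)} (hL : IsLogic L)
include hL

theorem mem_of_forall {φ : Formula n} (h : ∀ v, IsValuation v → v φ) : φ ∈ L :=
  hL.taut φ fun v hb hi => h v ⟨hb, hi⟩

theorem mem_of_mem {φ ψ : Formula n} (hφ : φ ∈ L) (h : ∀ v, IsValuation v → v φ → v ψ) :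
    ψ ∈ L :=
  hL.mp φ ψ (hL.mem_of_forall fun v hv => (hv.imp _ _).2 (h v hv)) hφ

theorem mem_of_mem₂ {φ ψ χ : Formula n} (hφ : φ ∈ L) (hψ : ψ ∈ L)
    (h : ∀ v, IsValuation v → v φ → v ψ → v χ) : χ ∈ L :=
  hL.mp ψ χ (hL.mem_of_mem hφ fun v hv h' => (hv.imp _ _).2 (h v hv h')) hψ

theorem imp_trans {φ ψ χ : Formula n} (h₁ : imp φ ψ ∈ L) (h₂ : imp ψ χ ∈ L) : imp φ χ ∈ L :=
  hL.mem_of_mem₂ h₁ h₂ fun v hv => by simp only [hv.imp]; tauto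

theorem imp_diaAny {φ ψ : Formula n} (h : imp φ ψ ∈ L) : imp φ.diaAny ψ.diaAny ∈ L := by
  have key : ∀ l : List (Fin n), imp (bigOr (l.map fun i => dia i φ))
      (bigOr (l.map fun i => dia i ψ)) ∈ L := by
    intro l
    induction l with
    | nil => exact hL.mem_of_forall fun v hv => by simp [hv.imp]
    | cons i l ih =>
      refine hL.mem_of_mem₂ ih (hL.mono i _ _ h) fun v hv => ?_
      simp only [List.map_cons, bigOr, hv.imp, hv.or]
      tauto
  simpa [diaAny, List.ofFn_eq_map] using key (List.finRange n)

theorem imp_diaPow {φ ψ : Formula n} (h : imp φ ψ ∈ L) (l : ℕ) :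
    imp (φ.diaPow l) (ψ.diaPow l) ∈ L := by
  induction l generalizing φ ψ with
  | zero => exact h
  | succ l ih => exact ih (hL.imp_diaAny h)

theorem neg_diaAny_bot : neg (diaAny bot) ∈ L := by
  have key : ∀ l : List (Fin n), neg (bigOr (l.map fun i => dia i bot)) ∈ L := by
    intro l
    induction l with
    | nil => exact hL.mem_of_forall fun v hv => by simp [hv.neg, bigOr, hv.bot]
    | cons i l ih =>
      refine hL.mem_of_mem₂ ih (hL.dia_bot i) fun v hv => ?_
      simp only [List.map_cons, bigOr, hv.neg, hv.or]
      tauto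
  simpa [diaAny, List.ofFn_eq_map] using key (List.finRange n)

theorem neg_diaPow_bot (l : ℕ) : neg (diaPow l bot) ∈ L := by
  induction l with
  | zero => exact hL.mem_of_forall fun v hv => by simp [hv.neg, diaPow, hv.bot]
  | succ l ih =>
    have h : imp (diaAny bot) bot ∈ L := hL.neg_diaAny_bot
    refine hL.mem_of_mem₂ ih (hL.imp_diaPow h l) fun v hv => ?_
    simp only [diaPow, hv.neg, hv.imp]
    tauto

theorem boxLe_mem {φ : Formula n} (h : φ ∈ L) (m : ℕ) : φ.boxLe m ∈ L := by
  have hb : imp φ.neg bot ∈ L := hL.mem_of_mem h fun v hv => by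
    simp only [hv.imp, hv.neg]; tauto
  have key : ∀ l : List ℕ, neg (bigOr (l.map fun j => φ.neg.diaPow j)) ∈ L := by
    intro l
    induction l with
    | nil => exact hL.mem_of_forall fun v hv => by simp [hv.neg, bigOr, hv.bot]
    | cons j l ih =>
      have hj : neg (φ.neg.diaPow j) ∈ L :=
        hL.mem_of_mem₂ (hL.imp_diaPow hb j) (hL.neg_diaPow_bot j) fun v hv => by
          simp only [hv.imp, hv.neg]; tauto
      refine hL.mem_of_mem₂ ih hj fun v hv => ?_
      simp only [List.map_cons, bigOr, hv.neg, hv.or]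
      tauto
  exact key _

/-- B_j is a disjunct under the box of B_{j+1}, so necessitation suffices. This makes L[i] an
extension of L[h] for i ≤ h, and tabularity passes to it. -/
theorem heightFormula_mem_of_le {m i j : ℕ} (hij : i ≤ j) (h : heightFormula m i ∈ L) :
    heightFormula m j ∈ L := by
  induction j, hij using Nat.le_induction with
  | base => exact h
  | succ j _ ih =>
    have hor : or (diaLe m (var (j + 1))) (heightFormula m j) ∈ L :=
      hL.mem_of_mem ih fun v hv => by simp only [hv.or]; tauto
    exact hL.mem_of_mem (hL.boxLe_mem hor m) fun v hv => by
      simp only [heightFormula, hv.imp]; tauto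

end IsLogic

/-! ### Points of the canonical frame -/

namespace CanonicalPoint

variable {L : Set (Formula n)} {k : ℕ}

theorem isKFormula (x : CanonicalPoint L k) {φ : Formula n} (h : φ ∈ x.1) : φ.IsKFormula k :=
  x.2.1.1 φ h

variable (hL : IsLogic L)
include hL

theorem exists_list_of_notMem (x : CanonicalPoint L k) {φ : Formula n} (hφ : φ.IsKFormula k)
    (h : φ ∉ x.1) : ∃ l : List (Formula n), (∀ ψ ∈ l, ψ ∈ x.1) ∧ imp (bigAnd l) φ.neg ∈ L := by
  classical
  by_contra! hcon
  refine h (x.2.2 (y := insert φ x.1) ⟨?_, ?_⟩ (Set.subset_insert φ x.1) (Set.mem_insert φ x.1))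
  · rintro ψ (rfl | hψ)
    · exact hφ
    · exact x.isKFormula hψ
  · intro l hl hneg
    refine hcon (l.filter (· ≠ φ)) (fun ψ hψ => ?_) (hL.mem_of_mem hneg fun v hv hn => ?_)
    · simp only [List.mem_filter, decide_eq_true_eq] at hψ
      exact (hl ψ hψ.1).resolve_left hψ.2
    · simp only [hv.imp, hv.neg, hv.bigAnd, List.mem_filter, decide_eq_true_eq] at hn ⊢
      intro hall hv'
      refine hn fun ψ hψ => ?_
      by_cases e : ψ = φ
      · exact e ▸ hv'
      · exact hall ψ ⟨hψ, e⟩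

theorem mem_of_imp_bigAnd (x : CanonicalPoint L k) {l : List (Formula n)} {φ : Formula n}
    (hl : ∀ ψ ∈ l, ψ ∈ x.1) (hφ : φ.IsKFormula k) (h : imp (bigAnd l) φ ∈ L) : φ ∈ x.1 := by
  by_contra hn
  obtain ⟨l', hl', h'⟩ := x.exists_list_of_notMem hL hφ hn
  refine x.2.1.2 (l ++ l') (fun ψ hψ => ?_) (hL.mem_of_mem₂ h h' fun v hv => ?_)
  · exact (List.mem_append.1 hψ).elim (hl ψ) (hl' ψ)
  · simp only [hv.imp, hv.neg, hv.bigAnd, List.mem_append]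
    intro h₁ h₂ hall
    exact h₂ (fun ψ hψ => hall ψ (Or.inr hψ)) (h₁ fun ψ hψ => hall ψ (Or.inl hψ))

theorem bot_notMem (x : CanonicalPoint L k) : bot ∉ x.1 := fun h =>
  x.2.1.2 [bot] (by simpa using h) (hL.mem_of_forall fun v hv => by
    simp [hv.neg, hv.bigAnd, hv.bot])

theorem imp_mem_iff (x : CanonicalPoint L k) {φ ψ : Formula n} (hφ : φ.IsKFormula k)
    (hψ : ψ.IsKFormula k) : imp φ ψ ∈ x.1 ↔ (φ ∈ x.1 → ψ ∈ x.1) := by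
  constructor
  · intro h h'
    refine x.mem_of_imp_bigAnd hL (l := [imp φ ψ, φ]) (by simp [h, h']) hψ
      (hL.mem_of_forall fun v hv => ?_)
    simp [hv.imp, hv.bigAnd]
  · intro h
    by_cases h' : φ ∈ x.1
    · refine x.mem_of_imp_bigAnd hL (l := [ψ]) (by simp [h h']) ⟨hφ, hψ⟩
        (hL.mem_of_forall fun v hv => ?_)
      simp only [hv.imp, hv.bigAnd, List.mem_singleton, forall_eq]
      tauto
    · obtain ⟨l, hl, hn⟩ := x.exists_list_of_notMem hL hφ h'
      refine x.mem_of_imp_bigAnd hL hl ⟨hφ, hψ⟩ (hL.mem_of_mem hn fun v hv => ?_)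
      simp only [hv.imp, hv.neg]
      tauto

omit hL in
/-- Truth at a point of the canonical model in which all letters but `p_0, …, p_{k-1}` are
false everywhere. -/
def Holds (x : CanonicalPoint L k) (φ : Formula n) : Prop :=
  φ.subst (restrictLetters k) ∈ x.1

omit hL in
theorem holds_iff_mem (x : CanonicalPoint L k) {φ : Formula n} (h : φ.IsKFormula k) :
    x.Holds φ ↔ φ ∈ x.1 := by
  rw [Holds, h.subst_restrictLetters]

omit hL in
theorem holds_subst_restrictLetters (x : CanonicalPoint L k) (φ : Formula n) :
    x.Holds (φ.subst (restrictLetters k)) ↔ x.Holds φ := by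
  rw [Holds, subst_restrictLetters_idem, Holds]

theorem isValuation_holds (x : CanonicalPoint L k) : IsValuation x.Holds where
  bot := x.bot_notMem hL
  imp α β := x.imp_mem_iff hL (isKFormula_subst_restrictLetters k α)
    (isKFormula_subst_restrictLetters k β)

theorem holds_of_mem (x : CanonicalPoint L k) {φ : Formula n} (h : φ ∈ L) : x.Holds φ :=
  x.mem_of_imp_bigAnd hL (l := []) (by simp) (isKFormula_subst_restrictLetters k φ)
    (hL.mem_of_mem (hL.subst (restrictLetters k) φ h) fun v hv h => (hv.imp _ _).2 fun _ => h)

theorem Holds.mono {x : CanonicalPoint L k} {φ ψ : Formula n} (hφ : x.Holds φ)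
    (h : imp φ ψ ∈ L) : x.Holds ψ :=
  ((x.isValuation_holds hL).imp φ ψ).1 (x.holds_of_mem hL h) hφ

theorem eq_of_holds {x y : CanonicalPoint L k} (h : ∀ φ, x.Holds φ → y.Holds φ) : x = y := by
  have h' : ∀ φ, y.Holds φ → x.Holds φ := fun φ hy => by
    by_contra hx
    exact ((y.isValuation_holds hL).neg φ).1 (h _ (((x.isValuation_holds hL).neg φ).2 hx)) hy
  refine Subtype.ext (Set.ext fun φ => ⟨fun hφ => ?_, fun hφ => ?_⟩)
  · exact (y.holds_iff_mem (x.isKFormula hφ)).1 (h φ ((x.holds_iff_mem (x.isKFormula hφ)).2 hφ))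
  · exact (x.holds_iff_mem (y.isKFormula hφ)).1 (h' φ ((y.holds_iff_mem (y.isKFormula hφ)).2 hφ))

/-- Lindenbaum's lemma for sets of formulas directed by `L`-provable implication. -/
theorem exists_of_directedOn {Γ : Set (Formula n)} (hne : Γ.Nonempty)
    (hdir : DirectedOn (fun α β => imp β α ∈ L) Γ)
    (hcon : ∀ γ ∈ Γ, neg (γ.subst (restrictLetters k)) ∉ L) :
    ∃ x : CanonicalPoint L k, ∀ γ ∈ Γ, x.Holds γ := by
  have hF : Order.IsOfFiniteCharacter
      {Γ : Set (Formula n) | (∀ φ ∈ Γ, IsKFormula k φ) ∧ IsConsistentSet L Γ} := by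
    intro Γ
    constructor
    · rintro ⟨h₁, h₂⟩ Δ hΔ -
      exact ⟨fun φ hφ => h₁ φ (hΔ hφ), fun l hl => h₂ l fun φ hφ => hΔ (hl φ hφ)⟩
    · intro h
      refine ⟨fun φ hφ => ?_, fun l hl => ?_⟩
      · exact (h {φ} (by simpa using hφ) (Set.finite_singleton φ)).1 φ rfl
      · exact (h {φ | φ ∈ l} hl l.finite_toSet).2 l fun φ hφ => hφ
  -- By directedness a single member of Γ implies any finite conjunction, so members need only be
  -- consistent one at a time.
  have key : ∀ l : List (Formula n), (∀ φ ∈ l, φ ∈ subst (restrictLetters k) '' Γ) →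
      ∃ γ ∈ Γ, imp (γ.subst (restrictLetters k)) (bigAnd l) ∈ L := by
    intro l
    induction l with
    | nil =>
      intro _
      obtain ⟨γ, hγ⟩ := hne
      exact ⟨γ, hγ, hL.mem_of_forall fun v hv => by simp [hv.imp, hv.bigAnd]⟩
    | cons φ l ih =>
      intro hl
      obtain ⟨α, hα, hα'⟩ := ih fun ψ hψ => hl ψ (List.mem_cons_of_mem _ hψ)
      obtain ⟨β, hβ, rfl⟩ := hl φ List.mem_cons_self
      obtain ⟨γ, hγ, h₁, h₂⟩ := hdir α hα β hβ
      refine ⟨γ, hγ, hL.mem_of_mem₂ (hL.imp_trans (hL.subst (restrictLetters k) _ h₁) hα')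
        (hL.subst (restrictLetters k) _ h₂) fun v hv => ?_⟩
      simp only [bigAnd, Formula.subst, hv.imp, hv.and]
      tauto
  obtain ⟨x, hx, hmax⟩ := hF.exists_maximal (x := subst (restrictLetters k) '' Γ) <| by
    refine ⟨?_, fun l hl hneg => ?_⟩
    · rintro _ ⟨γ, -, rfl⟩
      exact isKFormula_subst_restrictLetters k γ
    · obtain ⟨γ, hγ, h⟩ := key l hl
      refine hcon γ hγ (hL.mem_of_mem₂ h hneg fun v hv => ?_)
      simp only [hv.imp, hv.neg]
      tauto
  exact ⟨⟨x, hmax⟩, fun γ hγ => hx ⟨γ, hγ, rfl⟩⟩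

end CanonicalPoint

end PretransModal

namespace PretransModal

open Formula

variable {n : ℕ}

namespace Frame

variable (F : Frame n)

/-- There is a path of length `l` from one point to another. -/
def RPow : ℕ → F.World → F.World → Prop
  | 0, x, y => x = y
  | l + 1, x, z => ∃ y, RPow l x y ∧ ∃ i, F.rel i y z

variable {F}

theorem RPow.rStar {l : ℕ} {x y : F.World} (h : F.RPow l x y) : F.RStar x y := by
  induction l generalizing y with
  | zero => exact h ▸ Relation.ReflTransGen.refl
  | succ l ih =>
    obtain ⟨z, hz, hzy⟩ := h
    exact Relation.ReflTransGen.tail (ih hz) hzy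

theorem RPow.head {l : ℕ} {x y z : F.World} {i : Fin n} (hxy : F.rel i x y) (h : F.RPow l y z) :
    F.RPow (l + 1) x z := by
  induction l generalizing z with
  | zero => exact ⟨x, rfl, i, h ▸ hxy⟩
  | succ l ih =>
    obtain ⟨w, hw, hwz⟩ := h
    exact ⟨w, ih hw, hwz⟩

end Frame

/-! ### Truth and saturation in the canonical frame -/

namespace CanonicalPoint

variable {L : Set (Formula n)} {k : ℕ} (hL : IsLogic L) (hc : IsConsistentLogic L)

theorem Holds.dia {x y : CanonicalPoint L k} {i : Fin n} {φ : Formula n}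
    (hxy : (canonicalFrame L hL hc k).rel i x y) (h : y.Holds φ) : x.Holds (dia i φ) :=
  hxy _ h

/-- The successor must satisfy Γ and refute every δ with ◇_i δ false at x. Such δ are closed under
disjunction, so the formulas γ ∧ ¬δ are directed. Each is consistent, since γ → δ in L would give
◇_i δ at x by monotonicity. -/
theorem exists_rel_of_directedOn {x : CanonicalPoint L k} {i : Fin n} {Γ : Set (Formula n)}
    (hne : Γ.Nonempty) (hdir : DirectedOn (fun α β => imp β α ∈ L) Γ)
    (h : ∀ γ ∈ Γ, x.Holds (Formula.dia i γ)) :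
    ∃ y : CanonicalPoint L k, (canonicalFrame L hL hc k).rel i x y ∧ ∀ γ ∈ Γ, y.Holds γ := by
  have hx := x.isValuation_holds hL
  have hbot : ¬ x.Holds (Formula.dia i bot) :=
    (hx.neg _).1 (x.holds_of_mem hL (hL.dia_bot i))
  let Δ : Set (Formula n) :=
    {χ | ∃ γ ∈ Γ, ∃ δ, ¬ x.Holds (Formula.dia i δ) ∧ χ = and γ (neg δ)}
  have hΔne : Δ.Nonempty := by
    obtain ⟨γ, hγ⟩ := hne
    exact ⟨_, γ, hγ, bot, hbot, rfl⟩
  have hΔdir : DirectedOn (fun α β => imp β α ∈ L) Δ := by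
    rintro _ ⟨γ₁, hγ₁, δ₁, hδ₁, rfl⟩ _ ⟨γ₂, hγ₂, δ₂, hδ₂, rfl⟩
    obtain ⟨γ, hγ, h₁, h₂⟩ := hdir γ₁ hγ₁ γ₂ hγ₂
    refine ⟨_, ⟨γ, hγ, or δ₁ δ₂, fun hor => ?_, rfl⟩, hL.mem_of_mem h₁ fun v hv => ?_,
      hL.mem_of_mem h₂ fun v hv => ?_⟩
    · have hax := hL.subst (fun j => if j = 0 then δ₁ else δ₂) _ (hL.dia_or i)
      have := hor.mono hL (ψ := or (Formula.dia i δ₁) (Formula.dia i δ₂)) (by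
        simpa [Formula.subst, Formula.or, neg] using hax)
      exact ((hx.or _ _).1 this).elim hδ₁ hδ₂
    all_goals
      simp only [hv.imp, hv.and, hv.neg, hv.or]
      tauto
  have hΔcon : ∀ γ ∈ Δ, neg (γ.subst (restrictLetters k)) ∉ L := by
    rintro _ ⟨γ, hγ, δ, hδ, rfl⟩ hneg
    have himp : imp (γ.subst (restrictLetters k)) (δ.subst (restrictLetters k)) ∈ L :=
      hL.mem_of_mem hneg fun v hv => by
        simp only [Formula.and, neg, Formula.subst, hv.imp, hv.bot]
        tauto
    have hδ' := (x.holds_subst_restrictLetters _).2 (h γ hγ)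
    exact hδ ((x.holds_subst_restrictLetters _).1 (hδ'.mono hL (hL.mono i _ _ himp)))
  obtain ⟨y, hy⟩ := exists_of_directedOn hL hΔne hΔdir hΔcon
  have hyv := y.isValuation_holds hL
  refine ⟨y, fun φ hφ => ?_, fun γ hγ => ((hyv.and _ _).1 (hy _ ⟨γ, hγ, bot, hbot, rfl⟩)).1⟩
  have hk := y.isKFormula hφ
  obtain ⟨γ, hγ⟩ := hne
  by_contra hn
  have hn' : ¬ x.Holds (Formula.dia i φ) := fun h' =>
    hn ((x.holds_iff_mem (φ := Formula.dia i φ) hk).1 h')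
  exact (hyv.neg _).1 ((hyv.and _ _).1 (hy _ ⟨γ, hγ, φ, hn', rfl⟩)).2
    ((y.holds_iff_mem hk).2 hφ)

theorem holds_dia_iff {x : CanonicalPoint L k} {i : Fin n} {φ : Formula n} :
    x.Holds (Formula.dia i φ) ↔
      ∃ y : CanonicalPoint L k, (canonicalFrame L hL hc k).rel i x y ∧ y.Holds φ := by
  constructor
  · intro h
    obtain ⟨y, hxy, hy⟩ := exists_rel_of_directedOn hL hc (x := x) (i := i) (Γ := {φ}) ⟨φ, rfl⟩
      (fun α hα β hβ => ⟨α, hα, hL.mem_of_forall fun v hv => (hv.imp _ _).2 id,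
        hL.mem_of_forall fun v hv => (hv.imp _ _).2 (by rw [hα, hβ]; exact id)⟩)
      (by simpa using h)
    exact ⟨y, hxy, hy φ rfl⟩
  · rintro ⟨y, hxy, hy⟩
    exact Holds.dia hL hc hxy hy

theorem holds_diaPow_iff {x : CanonicalPoint L k} {l : ℕ} {φ : Formula n} :
    x.Holds (φ.diaPow l) ↔
      ∃ y : CanonicalPoint L k, (canonicalFrame L hL hc k).RPow l x y ∧ y.Holds φ := by
  induction l generalizing φ with
  | zero =>
    constructor
    · exact fun h => ⟨x, rfl, h⟩
    · rintro ⟨y, hxy, hy⟩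
      have hxy : x = y := hxy
      exact hxy ▸ hy
  | succ l ih =>
    rw [diaPow, ih]
    constructor
    · rintro ⟨y, hxy, hy⟩
      obtain ⟨i, hi⟩ := ((y.isValuation_holds hL).diaAny φ).1 hy
      obtain ⟨z, hyz, hz⟩ := (holds_dia_iff hL hc).1 hi
      exact ⟨z, ⟨y, hxy, i, hyz⟩, hz⟩
    · rintro ⟨z, ⟨y, hxy, i, hyz⟩, hz⟩
      exact ⟨y, hxy, ((isValuation_holds hL _).diaAny φ).2 ⟨i, Holds.dia hL hc hyz hz⟩⟩

include hL in
/-- If a finite union of conditions that are monotone under provable implication covers a directed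
set of formulas, then one of them does. -/
theorem exists_forall_of_directedOn {ι : Type*} [Finite ι] {Γ : Set (Formula n)}
    (hne : Γ.Nonempty) (hdir : DirectedOn (fun α β => imp β α ∈ L) Γ)
    {P : ι → Formula n → Prop} (hP : ∀ i α β, imp α β ∈ L → P i α → P i β)
    (h : ∀ γ ∈ Γ, ∃ i, P i γ) : ∃ i, ∀ γ ∈ Γ, P i γ := by
  by_contra! hcon
  choose g hg hg' using hcon
  have : Nonempty Γ := hne.to_subtype
  have : IsTrans (Formula n) (fun α β => imp β α ∈ L) := ⟨fun _ _ _ h₁ h₂ => hL.imp_trans h₂ h₁⟩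
  -- One γ implies all the counterexamples `g i`, so any `P i` true of γ would be true of `g i`.
  obtain ⟨γ, hγ⟩ := hdir.directed_val.finite_le fun i => (⟨g i, hg i⟩ : Γ)
  obtain ⟨i, hi⟩ := h γ.1 γ.2
  exact hg' i (hP i _ _ (hγ i) hi)

theorem exists_rPow_of_directedOn {x : CanonicalPoint L k} {l : ℕ} {Γ : Set (Formula n)}
    (hne : Γ.Nonempty) (hdir : DirectedOn (fun α β => imp β α ∈ L) Γ)
    (h : ∀ γ ∈ Γ, x.Holds (γ.diaPow l)) :
    ∃ y : CanonicalPoint L k, (canonicalFrame L hL hc k).RPow l x y ∧ ∀ γ ∈ Γ, y.Holds γ := by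
  induction l generalizing Γ with
  | zero => exact ⟨x, rfl, h⟩
  | succ l ih =>
    obtain ⟨y, hxy, hy⟩ := ih (Γ := diaAny '' Γ) (hne.image _) (by
      rintro _ ⟨α, hα, rfl⟩ _ ⟨β, hβ, rfl⟩
      obtain ⟨γ, hγ, h₁, h₂⟩ := hdir α hα β hβ
      exact ⟨_, ⟨γ, hγ, rfl⟩, hL.imp_diaAny h₁, hL.imp_diaAny h₂⟩) (by
      rintro _ ⟨γ, hγ, rfl⟩
      exact h γ hγ)
    -- Pigeonhole over the finitely many modalities: the last step of the path uses one index for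
    -- all of Γ.
    obtain ⟨i, hi⟩ := exists_forall_of_directedOn hL hne hdir
      (P := fun i γ => y.Holds (Formula.dia i γ))
      (fun i α β hαβ hα => hα.mono hL (hL.mono i _ _ hαβ))
      (fun γ hγ => ((y.isValuation_holds hL).diaAny γ).1 (hy _ ⟨γ, hγ, rfl⟩))
    obtain ⟨z, hyz, hz⟩ := exists_rel_of_directedOn hL hc hne hdir hi
    exact ⟨z, ⟨y, hxy, i, hyz⟩, hz⟩

theorem exists_rStar_of_directedOn {x : CanonicalPoint L k} {m : ℕ} {Γ : Set (Formula n)}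
    (hne : Γ.Nonempty) (hdir : DirectedOn (fun α β => imp β α ∈ L) Γ)
    (h : ∀ γ ∈ Γ, x.Holds (γ.diaLe m)) :
    ∃ y : CanonicalPoint L k, (canonicalFrame L hL hc k).RStar x y ∧ ∀ γ ∈ Γ, y.Holds γ := by
  obtain ⟨l, hl⟩ := exists_forall_of_directedOn hL hne hdir
    (P := fun (l : Fin (m + 1)) γ => x.Holds (γ.diaPow l))
    (fun l α β hαβ hα => hα.mono hL (hL.imp_diaPow hαβ l)) (fun γ hγ => by
      obtain ⟨l, hl, h'⟩ := ((x.isValuation_holds hL).diaLe m γ).1 (h γ hγ)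
      exact ⟨⟨l, Nat.lt_succ_of_le hl⟩, h'⟩)
  obtain ⟨y, hxy, hy⟩ := exists_rPow_of_directedOn hL hc hne hdir hl
  exact ⟨y, hxy.rStar, hy⟩

/-- The formulas true at y are closed under conjunction, so one point reachable from x satisfies
them all, and that point is y. -/
theorem rStar_of_forall_holds {x y : CanonicalPoint L k} {m : ℕ}
    (h : ∀ φ, y.Holds φ → x.Holds (φ.diaLe m)) : (canonicalFrame L hL hc k).RStar x y := by
  have hy := y.isValuation_holds hL
  obtain ⟨z, hxz, hz⟩ := exists_rStar_of_directedOn hL hc (Γ := {φ | y.Holds φ})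
    ⟨top, hy.top⟩ (fun α hα β hβ => ⟨and α β, (hy.and α β).2 ⟨hα, hβ⟩,
      hL.mem_of_forall fun v hv => by simp only [hv.imp, hv.and]; tauto,
      hL.mem_of_forall fun v hv => by simp only [hv.imp, hv.and]; tauto⟩) h
  exact eq_of_holds hL hz ▸ hxz

variable {m : ℕ} (hm : IsTransitiveLogic m L)
include hm

theorem holds_diaLe_iff {x : CanonicalPoint L k} {φ : Formula n} :
    x.Holds (φ.diaLe m) ↔
      ∃ y : CanonicalPoint L k, (canonicalFrame L hL hc k).RStar x y ∧ y.Holds φ := by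
  constructor
  · intro h
    obtain ⟨l, -, hl⟩ := ((x.isValuation_holds hL).diaLe m φ).1 h
    obtain ⟨y, hxy, hy⟩ := (holds_diaPow_iff hL hc).1 hl
    exact ⟨y, hxy.rStar, hy⟩
  · rintro ⟨y, hxy, hy⟩
    induction hxy using Relation.ReflTransGen.head_induction_on with
    | refl => exact ((y.isValuation_holds hL).diaLe m φ).2 ⟨0, Nat.zero_le m, hy⟩
    | @head a b hab hb ih =>
      obtain ⟨i, hab⟩ := hab
      obtain ⟨l, hlm, hl⟩ := ((isValuation_holds hL b).diaLe m φ).1 ih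
      obtain ⟨z, hbz, hz⟩ := (holds_diaPow_iff hL hc).1 hl
      have ha : Holds a (φ.diaPow (l + 1)) := (holds_diaPow_iff hL hc).2 ⟨z, hbz.head hab, hz⟩
      -- Only a path of length m + 1 exceeds the bound; the pretransitivity axiom shortens it.
      rcases hlm.lt_or_eq with hlt | rfl
      · exact ((isValuation_holds hL a).diaLe m φ).2 ⟨l + 1, hlt, ha⟩
      · have hax := hL.subst (fun _ => φ) _ hm
        simp only [Formula.subst, subst_diaPow, subst_diaLe] at hax
        exact ha.mono hL hax

theorem holds_boxLe_iff {x : CanonicalPoint L k} {φ : Formula n} :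
    x.Holds (φ.boxLe m) ↔
      ∀ y : CanonicalPoint L k, (canonicalFrame L hL hc k).RStar x y → y.Holds φ := by
  rw [boxLe, (x.isValuation_holds hL).neg, holds_diaLe_iff hL hc hm]
  push Not
  exact forall₂_congr fun y _ => by rw [(y.isValuation_holds hL).neg, not_not]

/-! ### Depth -/

/-- If y is strictly above x, some α holds at x while ◇*α fails at y. Putting α for p_{i+1} in
B_{i+1} then forces any chosen instance of B_i at y. The separating α varies with y, hence the
quantifier over all substitutions. -/
theorem depth_le_iff {x : CanonicalPoint L k} {i : ℕ} :
    (canonicalFrame L hL hc k).depth x ≤ (i : ℕ∞) ↔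
      ∀ σ, x.Holds ((heightFormula m i).subst σ) := by
  induction i generalizing x with
  | zero =>
    refine iff_of_false (Frame.not_depth_le_zero (canonicalFrame L hL hc k) x) fun h => ?_
    exact (x.isValuation_holds hL).bot (h var)
  | succ i ih =>
    refine (Frame.depth_le_add_one_iff (canonicalFrame L hL hc k) x i).trans ?_
    simp only [subst_heightFormula_succ, (x.isValuation_holds hL).imp, holds_boxLe_iff hL hc hm]
    constructor
    · intro h σ hx y hxy
      rw [(y.isValuation_holds hL).or]
      by_cases hyx : (canonicalFrame L hL hc k).RStar y x
      · exact Or.inl ((holds_diaLe_iff hL hc hm).2 ⟨x, hyx, hx⟩)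
      · exact Or.inr (ih.1 (h y hxy hyx) σ)
    · intro h y hxy hyx
      refine ih.2 fun σ => ?_
      obtain ⟨α, hα, hα'⟩ : ∃ α, x.Holds α ∧ ¬ Holds y (α.diaLe m) := by
        by_contra! hcon
        exact hyx (rStar_of_forall_holds hL hc hcon)
      have h' := h (Function.update σ (i + 1) α)
      rw [Function.update_self] at h'
      have h'' := ((isValuation_holds hL y).or _ _).1 (h' hα y hxy)
      rw [subst_heightFormula_congr (τ := σ) m i fun j hj =>
        Function.update_of_ne (by omega) _ _] at h''
      exact h''.resolve_left hα'

/-- The logic `L + B_i` holds at all points of depth at most `i`. -/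
theorem holds_of_mem_of_depth_le {x : CanonicalPoint L k} {i : ℕ}
    (h : (canonicalFrame L hL hc k).depth x ≤ (i : ℕ∞)) {φ : Formula n}
    (hφ : φ ∈ addAxioms L {heightFormula m i}) : x.Holds φ := by
  -- Quantifying over σ gives closure under substitution; quantifying over the whole cone gives
  -- closure under monotonicity.
  have hlogic : IsLogic {φ | ∀ σ, ∀ y : CanonicalPoint L k,
      (canonicalFrame L hL hc k).RStar x y → y.Holds (φ.subst σ)} := by
    refine ⟨?_, ?_, ?_, ?_, ?_, ?_⟩
    · exact fun φ hφ σ y _ => y.holds_of_mem hL (hL.subst σ _ (hL.taut φ hφ))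
    · exact fun i σ y _ => y.holds_of_mem hL (hL.subst σ _ (hL.dia_or i))
    · exact fun i σ y _ => y.holds_of_mem hL (hL.subst σ _ (hL.dia_bot i))
    · exact fun φ ψ h₁ h₂ σ y hy =>
        ((y.isValuation_holds hL).imp _ _).1 (h₁ σ y hy) (h₂ σ y hy)
    · intro τ φ h σ y hy
      rw [subst_subst]
      exact h _ y hy
    · intro i φ ψ h σ y hy
      refine ((y.isValuation_holds hL).imp _ _).2 fun hd => ?_
      obtain ⟨z, hyz, hz⟩ := (holds_dia_iff hL hc).1 hd
      exact Holds.dia hL hc hyz (((z.isValuation_holds hL).imp _ _).1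
        (h σ z (Relation.ReflTransGen.tail hy ⟨i, hyz⟩)) hz)
  rw [← holds_subst_restrictLetters]
  refine hφ _ ⟨hlogic, Set.union_subset ?_ ?_⟩ _ x Relation.ReflTransGen.refl
  · exact fun ψ hψ σ y _ => y.holds_of_mem hL (hL.subst σ ψ hψ)
  · rintro _ rfl σ y hy
    exact (depth_le_iff hL hc hm).1 ((Frame.depth_anti _ hy).trans h) σ

end CanonicalPoint

/-! ### Tabularity -/

/-- The multiplication table of a finite free algebra: for a `k`-tabular logic `Λ` there is a single
`k`-formula in `Λ` that entails all of `Λ` wherever it holds throughout a cone. -/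
theorem IsTabular.exists_axiom {Λ : Set (Formula n)} {k : ℕ} (hΛ : IsLogic Λ)
    (htab : IsTabular k Λ) {L : Set (Formula n)} (hL : IsLogic L) (hc : IsConsistentLogic L) :
    ∃ D : Formula n, D.IsKFormula k ∧ D ∈ Λ ∧ ∀ x : CanonicalPoint L k,
      (∀ y : CanonicalPoint L k, (canonicalFrame L hL hc k).RStar x y → y.Holds D) →
        ∀ φ ∈ Λ, x.Holds φ := by
  obtain ⟨S, hSfin, hSk, hS⟩ := htab
  -- `A` collects the representatives, letters, ⊥, and connectives applied to representatives. `T`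
  -- records which representative each k-formula of `A` equals in Λ, and which representatives are
  -- theorems of Λ.
  let A : Set (Formula n) := S ∪ {bot} ∪ var '' Set.Iio k ∪ Set.image2 imp S S ∪
    Set.image2 dia Set.univ S
  let T : Set (Formula n) := {χ | χ ∈ Λ ∧ χ.IsKFormula k} ∩ (S ∪ Set.image2 iff A S)
  have hAfin : A.Finite :=
    ((((hSfin.union (Set.finite_singleton _)).union ((Set.finite_Iio k).image _)).union
      (hSfin.image2 _ hSfin)).union (Set.finite_univ.image2 _ hSfin))
  have hTfin : T.Finite := (hSfin.union (hAfin.image2 _ hSfin)).inter_of_right _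
  have hTmem : ∀ χ ∈ hTfin.toFinset.toList, χ ∈ T := fun χ hχ => by simpa using hχ
  have hAnd : ∀ l : List (Formula n), (∀ χ ∈ l, χ ∈ Λ) → bigAnd l ∈ Λ := by
    intro l hl
    induction l with
    | nil => exact hΛ.mem_of_forall fun v hv => hv.top
    | cons φ l ih =>
      refine hΛ.mem_of_mem₂ (hl φ List.mem_cons_self)
        (ih fun χ hχ => hl χ (List.mem_cons_of_mem _ hχ)) fun v hv h₁ h₂ => ?_
      exact (hv.and _ _).2 ⟨h₁, h₂⟩
  refine ⟨bigAnd hTfin.toFinset.toList, IsKFormula.bigAnd fun χ hχ => (hTmem χ hχ).1.2,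
    hAnd _ fun χ hχ => (hTmem χ hχ).1.1, fun x hx => ?_⟩
  have hT : ∀ χ ∈ T, ∀ y : CanonicalPoint L k, (canonicalFrame L hL hc k).RStar x y →
      y.Holds χ := fun χ hχ y hy =>
    ((y.isValuation_holds hL).bigAnd _).1 (hx y hy) χ (by simpa using hχ)
  have hA : ∀ a ∈ A, a.IsKFormula k → ∃ s ∈ S, iff a s ∈ Λ ∧ ∀ y : CanonicalPoint L k,
      (canonicalFrame L hL hc k).RStar x y → (y.Holds a ↔ y.Holds s) := by
    intro a ha hak
    obtain ⟨s, hs, has⟩ := hS a hak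
    refine ⟨s, hs, has, fun y hy => ((y.isValuation_holds hL).iff _ _).1 (hT _ ⟨⟨has, ?_⟩,
      Or.inr ⟨a, ha, s, hs, rfl⟩⟩ y hy)⟩
    have hsk := hSk s hs
    simp [Formula.iff, Formula.and, neg, IsKFormula, hak, hsk]
  -- The table lets each k-formula be evaluated by induction: the same representative serves in Λ
  -- and at all points of the cone. The ◇ case needs the equivalence at successors, hence the cone.
  have hrep : ∀ φ : Formula n, φ.IsKFormula k → ∃ s ∈ S, iff φ s ∈ Λ ∧
      ∀ y : CanonicalPoint L k, (canonicalFrame L hL hc k).RStar x y →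
        (y.Holds φ ↔ y.Holds s) := by
    intro φ
    induction φ with
    | var j => exact fun hj => hA _ (Or.inl (Or.inl (Or.inr ⟨j, hj, rfl⟩))) hj
    | bot => exact hA _ (Or.inl (Or.inl (Or.inl (Or.inr rfl))))
    | imp φ ψ ihφ ihψ =>
      rintro ⟨hφ, hψ⟩
      obtain ⟨s, hs, hφs, hs'⟩ := ihφ hφ
      obtain ⟨t, ht, hψt, ht'⟩ := ihψ hψ
      obtain ⟨u, hu, hu', hu''⟩ := hA (imp s t) (Or.inl (Or.inr ⟨s, hs, t, ht, rfl⟩))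
        ⟨hSk s hs, hSk t ht⟩
      refine ⟨u, hu, hΛ.mem_of_mem₂ (hΛ.mem_of_mem₂ hφs hψt (χ := iff (imp φ ψ) (imp s t))
        fun v hv => ?_) hu' fun v hv => ?_, fun y hy => ?_⟩
      · simp only [hv.iff, hv.imp]; tauto
      · simp only [hv.iff]; tauto
      · rw [← hu'' y hy, (y.isValuation_holds hL).imp, (y.isValuation_holds hL).imp,
          hs' y hy, ht' y hy]
    | dia i φ ih =>
      intro hφ
      obtain ⟨s, hs, hφs, hs'⟩ := ih hφ
      obtain ⟨u, hu, hu', hu''⟩ := hA (dia i s) (Or.inr ⟨i, trivial, s, hs, rfl⟩) (hSk s hs)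
      have h₁ := hΛ.mono i φ s (hΛ.mem_of_mem hφs fun v hv => by
        simp only [hv.iff, hv.imp]; tauto)
      have h₂ := hΛ.mono i s φ (hΛ.mem_of_mem hφs fun v hv => by
        simp only [hv.iff, hv.imp]; tauto)
      refine ⟨u, hu, hΛ.mem_of_mem₂ (hΛ.mem_of_mem₂ h₁ h₂ (χ := iff (dia i φ) (dia i s))
        fun v hv => ?_) hu' fun v hv => ?_, fun y hy => ?_⟩
      · simp only [hv.iff, hv.imp]; tauto
      · simp only [hv.iff]; tauto
      · rw [← hu'' y hy, CanonicalPoint.holds_dia_iff hL hc, CanonicalPoint.holds_dia_iff hL hc]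
        refine exists_congr fun z => and_congr_right fun hyz => hs' z ?_
        exact Relation.ReflTransGen.tail hy ⟨i, hyz⟩
  intro φ hφ
  rw [← CanonicalPoint.holds_subst_restrictLetters]
  obtain ⟨s, hs, hφs, hs'⟩ := hrep _ (isKFormula_subst_restrictLetters k φ)
  have hsΛ : s ∈ Λ := hΛ.mem_of_mem₂ hφs (hΛ.subst (restrictLetters k) φ hφ) fun v hv => by
    simp only [hv.iff]; tauto
  exact (hs' x Relation.ReflTransGen.refl).2
    (hT s ⟨⟨hsΛ, hSk s hs⟩, Or.inl hs⟩ x Relation.ReflTransGen.refl)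

theorem IsTabular.mono {Λ Λ' : Set (Formula n)} {k : ℕ} (h : IsTabular k Λ) (hsub : Λ ⊆ Λ') :
    IsTabular k Λ' := by
  obtain ⟨S, hS, hSk, hS'⟩ := h
  refine ⟨S, hS, hSk, fun φ hφ => ?_⟩
  obtain ⟨ψ, hψ, h⟩ := hS' φ hφ
  exact ⟨ψ, hψ, hsub h⟩

theorem subset_addAxioms (L Ψ : Set (Formula n)) : L ∪ Ψ ⊆ addAxioms L Ψ :=
  fun _ hφ _ hL' => hL'.2 hφ

theorem addAxioms_heightFormula_anti (L : Set (Formula n)) (m : ℕ) {i j : ℕ} (hij : i ≤ j) :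
    addAxioms L {heightFormula m j} ⊆ addAxioms L {heightFormula m i} := by
  intro φ hφ
  refine hφ _ ⟨isLogic_addAxioms _ _, Set.union_subset ?_ ?_⟩
  · exact fun ψ hψ => subset_addAxioms _ _ (Or.inl hψ)
  · rintro _ rfl
    exact (isLogic_addAxioms _ _).heightFormula_mem_of_le hij (subset_addAxioms _ _ (Or.inr rfl))

/-- If `L + B_i` is `k`-tabular, then a `k`-formula defines depth at most `i`. -/
theorem exists_depth_formula {L : Set (Formula n)} (hL : IsLogic L) (hc : IsConsistentLogic L)
    {m k i : ℕ} (hm : IsTransitiveLogic m L)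
    (htab : IsTabular k (addAxioms L {heightFormula m i})) :
    ∃ B : Formula n, B.IsKFormula k ∧ ∀ x : CanonicalPoint L k,
      B ∈ x.1 ↔ (canonicalFrame L hL hc k).depth x ≤ (i : ℕ∞) := by
  have hΛ := isLogic_addAxioms L {heightFormula m i}
  obtain ⟨D, hDk, hDΛ, hD⟩ := htab.exists_axiom hΛ hL hc
  refine ⟨D.boxLe m, hDk.boxLe m, fun x => ?_⟩
  rw [← x.holds_iff_mem (hDk.boxLe m), CanonicalPoint.holds_boxLe_iff hL hc hm]
  constructor
  · intro h
    refine (CanonicalPoint.depth_le_iff hL hc hm).2 fun σ => hD x h _ ?_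
    exact hΛ.subst σ _ (subset_addAxioms _ _ (Or.inr rfl))
  · intro h y hxy
    exact CanonicalPoint.holds_of_mem_of_depth_le hL hc hm
      ((Frame.depth_anti _ hxy).trans h) hDΛ

/-! ### Maximal points and heaviness -/

/-- In the canonical frame of a pretransitive logic, every point at which `φ` holds sees a point
that is `R^*`-maximal among those at which `φ` holds. -/
theorem CanonicalPoint.exists_maximal_holds {L : Set (Formula n)} (hL : IsLogic L)
    (hc : IsConsistentLogic L) {m k : ℕ} (hm : IsTransitiveLogic m L) {φ : Formula n}
    {x : CanonicalPoint L k} (hx : x.Holds φ) :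
    ∃ y : CanonicalPoint L k, (canonicalFrame L hL hc k).RStar x y ∧ y.Holds φ ∧
      ∀ z : CanonicalPoint L k, (canonicalFrame L hL hc k).RStar y z → z.Holds φ →
        (canonicalFrame L hL hc k).RStar z y := by
  let X := {y : CanonicalPoint L k // (canonicalFrame L hL hc k).RStar x y ∧ y.Holds φ}
  let r : X → X → Prop := fun y z => (canonicalFrame L hL hc k).RStar y.1 z.1
  have : Nonempty X := ⟨⟨x, Relation.ReflTransGen.refl, hx⟩⟩
  have hub : ∀ C, IsChain r C → C.Nonempty → ∃ ub, ∀ y ∈ C, r y ub := by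
    intro C hC hCne
    have : Std.Refl r := ⟨fun _ => Relation.ReflTransGen.refl⟩
    -- An upper bound of `C` must satisfy φ and every ψ with □*ψ true somewhere on `C`. Boxed
    -- formulas persist upwards, so the chain condition makes `Δ` directed.
    let Δ : Set (Formula n) := {χ | ∃ ψ, (∃ y ∈ C, y.1.Holds (ψ.boxLe m)) ∧ χ = and ψ φ}
    have hΔne : Δ.Nonempty := by
      obtain ⟨y, hy⟩ := hCne
      exact ⟨_, top, ⟨y, hy, (holds_boxLe_iff hL hc hm).2 fun w _ =>
        (w.isValuation_holds hL).top⟩, rfl⟩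
    have hΔdir : DirectedOn (fun α β => imp β α ∈ L) Δ := by
      rintro _ ⟨ψ₁, ⟨y₁, hy₁, h₁⟩, rfl⟩ _ ⟨ψ₂, ⟨y₂, hy₂, h₂⟩, rfl⟩
      rw [holds_boxLe_iff hL hc hm] at h₁ h₂
      obtain ⟨w, hw, hw₁, hw₂⟩ : ∃ w ∈ C, r y₁ w ∧ r y₂ w := hC.directedOn y₁ hy₁ y₂ hy₂
      refine ⟨_, ⟨and ψ₁ ψ₂, ⟨w, hw, (holds_boxLe_iff hL hc hm).2 fun u hu =>
        ((u.isValuation_holds hL).and _ _).2 ⟨h₁ u (hw₁.trans hu), h₂ u (hw₂.trans hu)⟩⟩, rfl⟩,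
        hL.mem_of_forall fun v hv => ?_, hL.mem_of_forall fun v hv => ?_⟩
      all_goals
        simp only [hv.imp, hv.and]
        tauto
    have hΔcon : ∀ γ ∈ Δ, neg (γ.subst (restrictLetters k)) ∉ L := by
      rintro _ ⟨ψ, ⟨y, hy, h⟩, rfl⟩ hneg
      have hyv := y.1.isValuation_holds hL
      have hψ := (holds_boxLe_iff hL hc hm).1 h y.1 Relation.ReflTransGen.refl
      have hneg' : y.1.Holds ((and ψ φ).neg) :=
        (y.1.holds_subst_restrictLetters _).1 (y.1.holds_of_mem hL hneg)
      exact (hyv.neg _).1 hneg' ((hyv.and _ _).2 ⟨hψ, y.2.2⟩)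
    obtain ⟨z, hz⟩ := exists_of_directedOn hL hΔne hΔdir hΔcon
    have hzv := z.isValuation_holds hL
    have hz' : ∀ y ∈ C, (canonicalFrame L hL hc k).RStar y.1 z := by
      refine fun y hy => rStar_of_forall_holds hL hc (m := m) fun ψ hψ => ?_
      by_contra hcon
      rw [holds_diaLe_iff hL hc hm] at hcon
      push Not at hcon
      have hbox : y.1.Holds (ψ.neg.boxLe m) := (holds_boxLe_iff hL hc hm).2 fun w hw =>
        ((w.isValuation_holds hL).neg ψ).2 (hcon w hw)
      exact (hzv.neg _).1 ((hzv.and _ _).1 (hz _ ⟨_, ⟨y, hy, hbox⟩, rfl⟩)).1 hψ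
    obtain ⟨y, hy⟩ := hCne
    -- The choice ψ = ⊤ puts φ itself at the bound `z`.
    have htop : y.1.Holds (boxLe m top) := (holds_boxLe_iff hL hc hm).2 fun w _ =>
      (w.isValuation_holds hL).top
    exact ⟨⟨z, y.2.1.trans (hz' y hy), ((hzv.and _ _).1 (hz _ ⟨_, ⟨y, hy, htop⟩, rfl⟩)).2⟩,
      fun w hw => hz' w hw⟩
  obtain ⟨y, hy⟩ := exists_maximal_of_nonempty_chains_bounded hub
    fun h₁ h₂ => Relation.ReflTransGen.trans h₁ h₂
  exact ⟨y.1, y.2.1, y.2.2, fun z hyz hz => hy ⟨z, y.2.1.trans hyz, hz⟩ hyz⟩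

end PretransModal

open PretransModal in
theorem mainTheorem2 (n : ℕ) (hn : 0 < n) (L : Set (PretransModal.Formula n))
    (hL : PretransModal.IsLogic L) (hc : PretransModal.IsConsistentLogic L)
    (hpre : PretransModal.IsPretransitive L) (h k : ℕ)
    (htab : PretransModal.IsTabular k (PretransModal.heightExtension L h)) :
    (∀ i ≤ h, ∃ B : PretransModal.Formula n, B.IsKFormula k ∧
      ∀ x : PretransModal.CanonicalPoint L k,
        B ∈ x.1 ↔ (PretransModal.canonicalFrame L hL hc k).depth x ≤ (i : ℕ∞)) ∧
    (PretransModal.canonicalFrame L hL hc k).IsHeavy (h + 1) := by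
  have hm : IsTransitiveLogic (transIndex L) L := Nat.sInf_mem hpre
  have hB : ∀ i ≤ h, ∃ B : Formula n, B.IsKFormula k ∧ ∀ x : CanonicalPoint L k,
      B ∈ x.1 ↔ (canonicalFrame L hL hc k).depth x ≤ (i : ℕ∞) := fun i hi =>
    exists_depth_formula hL hc hm (htab.mono (addAxioms_heightFormula_anti L _ hi))
  refine ⟨hB, fun x hx => ?_⟩
  obtain ⟨B, hBk, hB⟩ := hB h le_rfl
  have hneg : ∀ y : CanonicalPoint L k,
      y.Holds B.neg ↔ ¬ (canonicalFrame L hL hc k).depth y ≤ (h : ℕ∞) := fun y => by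
    rw [(y.isValuation_holds hL).neg, y.holds_iff_mem hBk, hB]
  have hx' : CanonicalPoint.Holds x B.neg := (hneg x).2 fun hle =>
    hx (hle.trans (by exact_mod_cast h.le_succ))
  obtain ⟨y, hxy, hy, hmax⟩ := CanonicalPoint.exists_maximal_holds hL hc hm hx'
  refine ⟨y, hxy, le_antisymm ?_ ?_⟩
  -- A point strictly above `y` of depth not ≤ h would satisfy ¬B, against the maximality of `y`.
  · refine (Frame.depth_le_add_one_iff (canonicalFrame L hL hc k) y h).2 fun z hyz hzy => ?_
    by_contra hz
    exact hzy (hmax z hyz ((hneg z).2 hz))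
  · push_cast
    exact Order.add_one_le_of_lt (not_le.1 ((hneg y).1 hy))
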